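/- Let $X$ be a reflexive real Banach space such that $X$ and its dual $X^*$ are locally uniformly convex and the norm of $X$ is Fréchet differentiable at every nonzero point. Norm $X\times\mathbb R$ by $\|(x,y)\|=\|x\|+|y|$. Definitions. For a set $\Omega$ in a normed space $E$, $\bar x\in\Omega$ and $\epsilon\ge 0$, let $T(\bar x,\Omega)$ be the set of all $v\in E$ for which there are $t_k>0$, $t_k\to0$ and $v_k\to v$ with $\bar x+t_kv_k\in\Omega$ for all $k$, and let $$\widehat N_\epsilon(\bar x,\Omega)=\Big\{x^*\in E^*:\ \limsup_{x\to\bar x,\ x\in\Omega,\ x\neq\bar x}\frac{\langle x^*,x-\bar x\rangle}{\|x-\bar x\|}\le\epsilon\Big\}$$ (the upper limit being $-\infty$ if $\bar x$ is isolated in $\Omega$). Let $J(v)=\{x^*\in X^*:\langle x^*,v\rangle=\|v\|^2=\|x^*\|^2\}$ and $J(T)=\bigcup_{v\in T}J(v)$. For $\Omega\subset X$ and $f:X\to\mathbb R\cup\{\pm\infty\}$, let $f_\Omega=f$ on $\Omega$ and $f_\Omega=+\infty$ off $\Omega$, and let $\operatorname{epi}f_\Omega=\{(x,y)\in X\times\mathbb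 R: y\ge f_\Omega(x)\}$. If $\bar x\in\Omega$ and $f(\bar x)$ is finite, the $\epsilon$-regular subdifferential of $f$ relative to $\Omega$ at $\bar x$ is $$\widehat\partial^{\,\epsilon}_\Omega f(\bar x)=\big\{x^*\in X^*:\ (x^*,-1)\in\widehat N_\epsilon\big((\bar x,f(\bar x)),\operatorname{epi}f_\Omega\big)\big\}\cap J\big(T(\bar x,\Omega)\big);$$ it is empty if $\bar x\notin\Omega$ or $f(\bar x)$ is infinite. Theorem. Let $a\ne b$ be points of $X$ and let $f:X\to\mathbb R\cup\{\pm\infty\}$ be finite at $a$ and at $b$. Suppose that $f>-\infty$ on the segment $[a,b]$ and that $f$ is lower semicontinuous relative to $[a,b]$, i.e. $\liminf_{u\to x,\,u\in[a,b]}f(u)\ge f(x)$ for every $x\in[a,b]$ (including points with $f(x)=+\infty$). Let $c\in[a,b)$ be a point at which the function $$\varphi(x)=f(x)+\frac{f(b)-f(a)}{\|b-a\|}\,\|x-b\|$$ attains its minimum over $[a,b]$. Then for every nonincreasing sequence $\epsilon_k>0$ with $\epsilon_k\to0$ there are real numbers $\tilde\epsilon_k>0$ with $\tilde\epsilon_k\to0$,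 points $x_k\in[a,b]$ with $x_k\to c$ and $f(x_k)\to f(c)$, and functionals $x_k^*\in\widehat\partial^{\,\tilde\epsilon_k}_{[a,b]}f(x_k)$ such that $$\liminf_{k\to\infty}\langle x_k^*,b-a\rangle\ge f(b)-f(a),\qquad \liminf_{k\to\infty}\langle x_k^*,b-x_k\rangle\ge\frac{\|b-c\|}{\|b-a\|}\,(f(b)-f(a)),$$ the lower limits being taken in $[-\infty,+\infty]$; and if $c\ne a$, the same sequences also satisfy $$\lim_{k\to\infty}\langle x_k^*,b-a\rangle=f(b)-f(a).$$ -/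

import Mathlib

open Filter Topology

namespace RelSubdiff

noncomputable section

/-- A real normed space is locally uniformly convex: for every point `x` of the unit sphere and every
`ε > 0` there is `δ > 0` (depending on `x` and `ε`) such that `‖x + y‖ ≤ 2 - δ` for all `y` in the
unit sphere with `‖x - y‖ ≥ ε`. -/
def LocallyUniformlyConvex (E : Type*) [NormedAddCommGroup E] : Prop :=
  ∀ x : E, ‖x‖ = 1 → ∀ ε : ℝ, 0 < ε → ∃ δ : ℝ, 0 < δ ∧
    ∀ y : E, ‖y‖ = 1 → ε ≤ ‖x - y‖ → ‖x + y‖ ≤ 2 - δ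

/-- Reflexivity: the canonical embedding into the bidual is onto. -/
def Reflexive (E : Type*) [NormedAddCommGroup E] [NormedSpace ℝ E] : Prop :=
  Function.Surjective (NormedSpace.inclusionInDoubleDual ℝ E)

section General

variable {E : Type*} [NormedAddCommGroup E] [NormedSpace ℝ E]

/-- The duality mapping `J(x) = {x* | ⟨x*, x⟩ = ‖x‖² = ‖x*‖²}`. -/
def dualityMap (x : E) : Set (StrongDual ℝ E) :=
  {xs | xs x = ‖x‖ ^ 2 ∧ ‖x‖ ^ 2 = ‖xs‖ ^ 2}

/-- The (Bouligand) tangent cone `T(x, Ω)`: limits `v` of sequences `v_k` such that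
`x + t_k v_k ∈ Ω` for some positive `t_k → 0`. -/
def tangentCone (x : E) (Ω : Set E) : Set E :=
  {v | ∃ (t : ℕ → ℝ) (w : ℕ → E), (∀ k, 0 < t k) ∧ Tendsto t atTop (𝓝 0) ∧
    Tendsto w atTop (𝓝 v) ∧ ∀ k, x + t k • w k ∈ Ω}

/-- The set of `ε`-normals to `Ω` at a point `x ∈ Ω`: the upper limit of the quotients
`⟨x*, u - x⟩ / ‖u - x‖` as `u → x`, `u ∈ Ω`, `u ≠ x`, is at most `ε` (the upper limit is taken in the
extended reals, so it is `-∞` if `x` is isolated in `Ω`). Empty if `x ∉ Ω`. -/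
def epsNormal (ε : ℝ) (x : E) (Ω : Set E) : Set (StrongDual ℝ E) :=
  {xs | x ∈ Ω ∧
    limsup (fun u : E => ((xs (u - x) / ‖u - x‖ : ℝ) : EReal)) (𝓝[Ω \ {x}] x) ≤ (ε : EReal)}

end General

section Functions

variable {X : Type*} [NormedAddCommGroup X] [NormedSpace ℝ X]

open Classical in
/-- `f_Ω`: equal to `f` on `Ω` and to `∞` off `Ω`. -/
def restrictTop (f : X → EReal) (Ω : Set X) (x : X) : EReal := if x ∈ Ω then f x else ⊤

/-- The epigraph `{(x, y) ∈ X × ℝ | y ≥ f(x)}`, in `X × ℝ` with the norm `‖(x, y)‖ = ‖x‖ + |y|`. -/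
def epigraph (f : X → EReal) : Set (WithLp 1 (X × ℝ)) :=
  {p | f p.fst ≤ (p.snd : EReal)}

/-- The functional `(x*, r)` on `X × ℝ`: it maps `(x, y)` to `⟨x*, x⟩ + r y`. -/
def pairFunctional (xs : StrongDual ℝ X) (r : ℝ) : StrongDual ℝ (WithLp 1 (X × ℝ)) :=
  (xs.coprod (r • ContinuousLinearMap.id ℝ ℝ)).comp
    (WithLp.prodContinuousLinearEquiv 1 ℝ X ℝ : WithLp 1 (X × ℝ) →L[ℝ] X × ℝ)

theorem pairFunctional_apply (xs : StrongDual ℝ X) (r : ℝ) (p : WithLp 1 (X × ℝ)) :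
    pairFunctional xs r p = xs p.fst + r * p.snd := rfl

/-- The geometric `ε`-subdifferential of `f` at `x`: those `x*` for which `(x*, -1)` is an
`ε`-normal to the epigraph at `(x, f(x))`; empty if `f(x)` is infinite. -/
def geomSubdiff (ε : ℝ) (f : X → EReal) (x : X) : Set (StrongDual ℝ X) :=
  {xs | f x ≠ ⊤ ∧ f x ≠ ⊥ ∧
    pairFunctional xs (-1) ∈ epsNormal ε (WithLp.toLp 1 (x, (f x).toReal)) (epigraph f)}

/-- The `ε`-regular subdifferential of `f` relative to `Ω` at `x`:
`∂̂_ε f_Ω(x) ∩ J(T(x, Ω))`, where `J(T) = ⋃_{v ∈ T} J(v)`; empty if `x ∉ Ω` or `f(x)` is infinite. -/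
def relSubdiff (ε : ℝ) (Ω : Set X) (f : X → EReal) (x : X) : Set (StrongDual ℝ X) :=
  {xs | x ∈ Ω ∧ xs ∈ geomSubdiff ε (restrictTop f Ω) x ∧
    xs ∈ ⋃ v ∈ tangentCone x Ω, dualityMap v}

end Functions

end

end RelSubdiff

/-!
The statement is one-dimensional. Parametrize the segment by `t ↦ a + t (b - a)`, `t ∈ [0, 1]`, and
put `g t = f (a + t (b - a))`, `m = f b - f a`. A functional in `J (v)` with `v` tangent to the
segment is a multiple of a norming functional of `b - a`, which Hahn–Banach provides; so a real
slope `s` can be turned into an element `x*` of the relative subdifferential with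
`⟨x*, b - a⟩ = s` as soon as `s` is an `ε`-subgradient of `g` at `t < 1`, and `s ≥ 0` in the case
`t = 0`, where the tangent cone is only a half-line (`exists_mem_relSubdiff`).

That `c = a + τ (b - a)` minimizes `φ` says `g t ≥ g τ + m (t - τ)` on `[0, 1]`, so `m` itself is
a subgradient at `τ`. This settles the cases `0 < τ` and `0 ≤ m` with constant sequences. In the
remaining case `τ = 0`, `m < 0`, either `0` is an `ε`-subgradient of `g` at `0`, or `g` falls below
`g 0 - ε t` at points arbitrarily close to `0`. Then one minimizes `g + P` with a convex function
`P` that vanishes to second order at `0` and whose slope stays below, but quickly approaches,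
`δ - m`: the minimizer `t` is positive by the choice of `P` near `0`, it is close to `0` because
`g t + P t` is at least `g 0` away from `0`, and `- P' t > m - δ` is a subgradient of `g`
there (`exists_subgradient_near_left_end`).
-/

namespace RelSubdiff

open Set

/-! ### One-dimensional subgradients -/

/-- `s` is an `ε`-subgradient of `g` at `t` relative to `[0, 1]`, where `y` is the value of `g`
at `t`. -/
def IsUnitSubgradient (ε : ℝ) (g : ℝ → EReal) (t y s : ℝ) : Prop :=
  ∃ r : ℝ, 0 < r ∧ ∀ u ∈ Icc (0 : ℝ) 1, |u - t| < r →
    ((y + s * (u - t) - ε * |u - t| : ℝ) : EReal) ≤ g u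

/-- If `t` minimizes `g + P` over `[0, 1]` and `P` is differentiable at `t`, then `- P' t` is an
`ε`-subgradient of `g` at `t` for every `ε > 0`. -/
theorem isUnitSubgradient_neg_deriv {g : ℝ → EReal} {P : ℝ → ℝ} {t y P' ε : ℝ} (hε : 0 < ε)
    (hP : HasDerivAt P P' t)
    (hmin : ∀ u ∈ Icc (0 : ℝ) 1, ((y + P t : ℝ) : EReal) ≤ g u + (P u : EReal)) :
    IsUnitSubgradient ε g t y (-P') := by
  have hbound := (hasDerivAt_iff_isLittleO.1 hP).bound hε
  obtain ⟨r, hr, hball⟩ := Metric.eventually_nhds_iff.1 hbound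
  refine ⟨r, hr, fun u hu hut => ?_⟩
  have h₁ : |P u - P t - (u - t) * P'| ≤ ε * |u - t| := by
    simpa [Real.norm_eq_abs] using hball (by rwa [Real.dist_eq])
  have h₂ := (abs_le.1 h₁).2
  have h₃ := hmin u hu
  induction hgu : g u with
  | top => exact le_top
  | bot =>
    rw [hgu, EReal.bot_add] at h₃
    exact absurd (le_bot_iff.1 h₃) (EReal.coe_ne_bot _)
  | coe z =>
    rw [hgu, ← EReal.coe_add, EReal.coe_le_coe_iff] at h₃
    rw [EReal.coe_le_coe_iff]
    linarith

/-- A lower semicontinuous `g` with `g t ≥ g 0 + m t` on `[0, 1]`, `m < 0`, for which `0` is not an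
`ε`-subgradient at `0`, has a subgradient of slope at least `m - δ` at positive points arbitrarily
close to `0`. -/
theorem exists_subgradient_near_left_end {g : ℝ → EReal}
    (hlsc : LowerSemicontinuousOn g (Icc 0 1)) {y m ε δ : ℝ} (hy : g 0 = (y : EReal)) (hm : m < 0)
    (hmin : ∀ t ∈ Icc (0 : ℝ) 1, ((y + m * t : ℝ) : EReal) ≤ g t) (hε : 0 < ε) (hδ : 0 < δ)
    (hzero : ¬ IsUnitSubgradient ε g 0 y 0) :
    ∃ t z s : ℝ, t ∈ Ioo (0 : ℝ) 1 ∧ t < δ ∧ g t = (z : EReal) ∧ |z - y| < δ ∧ m - δ ≤ s ∧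
      IsUnitSubgradient ε g t z s := by
  set μ : ℝ := δ - m with hμ
  have hμpos : 0 < μ := by linarith
  set r : ℝ := min (min δ 1) (δ / -m) with hr
  have hrpos : 0 < r := lt_min (lt_min hδ one_pos) (div_pos hδ (neg_pos.2 hm))
  -- `K` is the value for which the minimizer of `g + P` is forced into `[0, r)`.
  set K : ℝ := -m / (δ * r) with hK
  have hKpos : 0 < K := div_pos (neg_pos.2 hm) (mul_pos hδ hrpos)
  have hden : ∀ t ∈ Icc (0 : ℝ) 1, 0 < 1 + K * t := fun t ht => by
    nlinarith [mul_nonneg hKpos.le ht.1]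
  set P : ℝ → ℝ := fun t => μ * (t - t / (1 + K * t)) with hP
  have hP_eq : ∀ t ∈ Icc (0 : ℝ) 1, P t * (1 + K * t) = μ * K * t ^ 2 := fun t ht => by
    have h : t / (1 + K * t) * (1 + K * t) = t := div_mul_cancel₀ _ (hden t ht).ne'
    simp only [hP]
    linear_combination -μ * h
  have hP_nonneg : ∀ t ∈ Icc (0 : ℝ) 1, 0 ≤ P t := fun t ht => by
    refine nonneg_of_mul_nonneg_left ?_ (hden t ht)
    rw [hP_eq t ht]
    positivity
  have hP_le : ∀ t ∈ Icc (0 : ℝ) 1, P t ≤ μ * K * t ^ 2 := fun t ht => by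
    rw [← hP_eq t ht]
    nlinarith [mul_nonneg (hP_nonneg t ht) (mul_nonneg hKpos.le ht.1)]
  have hP_cont : ContinuousOn P (Icc 0 1) := by
    refine continuousOn_const.mul (continuousOn_id.sub (continuousOn_id.div ?_ ?_))
    · fun_prop
    · exact fun t ht => (hden t ht).ne'
  have hsum_lsc : LowerSemicontinuousOn (fun t => g t + (P t : EReal)) (Icc 0 1) := by
    refine LowerSemicontinuousOn.add' hlsc ?_ fun t _ => ?_
    · exact (continuous_coe_real_ereal.comp_continuousOn hP_cont).lowerSemicontinuousOn
    · exact EReal.continuousAt_add (Or.inr (EReal.coe_ne_bot _)) (Or.inr (EReal.coe_ne_top _))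
  obtain ⟨t, ht, htmin⟩ := hsum_lsc.exists_isMinOn ⟨0, by simp⟩ isCompact_Icc
  -- `g + P` takes a value below `y`, since `P` vanishes to second order at `0`.
  obtain ⟨u, hu, huneg⟩ : ∃ u ∈ Icc (0 : ℝ) 1, g u + (P u : EReal) < (y : EReal) := by
    simp only [IsUnitSubgradient, not_exists, not_and, not_forall] at hzero
    obtain ⟨u, hu, hur, hgu⟩ := hzero (ε / (μ * K)) (by positivity)
    refine ⟨u, hu, ?_⟩
    rw [sub_zero, abs_of_nonneg hu.1] at hur hgu
    rw [not_le] at hgu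
    have hu0 : 0 < u := by
      refine lt_of_le_of_ne hu.1 fun h => ?_
      rw [← h, hy] at hgu
      simp at hgu
    have h₁ : μ * K * u < ε := by
      rw [lt_div_iff₀ (by positivity)] at hur
      linarith
    have h₂ : P u < ε * u := (hP_le u hu).trans_lt (by nlinarith)
    calc g u + (P u : EReal)
        ≤ ((y + 0 * u - ε * u : ℝ) : EReal) + (P u : EReal) := by gcongr
      _ = ((y + 0 * u - ε * u + P u : ℝ) : EReal) := by rw [EReal.coe_add]
      _ < (y : EReal) := by rw [EReal.coe_lt_coe_iff]; linarith
  have htneg : g t + (P t : EReal) < (y : EReal) := (htmin hu).trans_lt huneg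
  have htge := hmin t ht
  induction hgt : g t with
  | top => simp [hgt] at htneg
  | bot =>
    rw [hgt] at htge
    exact absurd (le_bot_iff.1 htge) (EReal.coe_ne_bot _)
  | coe z =>
  rw [hgt, ← EReal.coe_add, EReal.coe_lt_coe_iff] at htneg
  rw [hgt, EReal.coe_le_coe_iff] at htge
  have ht0 : 0 < t := by
    refine lt_of_le_of_ne ht.1 fun h => ?_
    rw [← h, hy, EReal.coe_eq_coe_iff] at hgt
    rw [← h, hgt] at htneg
    simp [hP] at htneg
  have htr : t < r := by
    have h₁ : (P t + m * t) * (1 + K * t) < 0 :=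
      mul_neg_of_neg_of_pos (by linarith) (hden t ht)
    have h₂ : t * (δ * K * t + m) < 0 := by
      have := hP_eq t ht
      rw [hμ] at this
      nlinarith
    have h₃ : δ * K * t + m < 0 := by
      by_contra! h
      nlinarith [mul_nonneg ht0.le h]
    have h₄ : δ * K * r = -m := by
      rw [hK]
      field_simp
    have h₅ : δ * K * t < δ * K * r := by linarith
    exact lt_of_mul_lt_mul_left h₅ (by positivity)
  have hmr : -m * t < δ := by
    have := htr.trans_le (min_le_right _ _)
    rw [lt_div_iff₀ (neg_pos.2 hm)] at this
    linarith
  have hPderiv : HasDerivAt P (μ * (1 - 1 / (1 + K * t) ^ 2)) t := by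
    have hd : HasDerivAt (fun t : ℝ => 1 + K * t) K t := by
      simpa using ((hasDerivAt_id t).const_mul K).const_add 1
    have := (((hasDerivAt_id t).sub ((hasDerivAt_id t).div hd (hden t ht).ne')).const_mul μ)
    refine this.congr_deriv ?_
    simp only [id]
    ring
  refine ⟨t, z, -(μ * (1 - 1 / (1 + K * t) ^ 2)), ⟨ht0, ?_⟩, ?_, hgt, ?_, ?_, ?_⟩
  · exact htr.trans_le ((min_le_left _ _).trans (min_le_right _ _))
  · exact htr.trans_le ((min_le_left _ _).trans (min_le_left _ _))
  · rw [abs_lt]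
    constructor <;> linarith [hP_nonneg t ht]
  · have : 0 ≤ μ * (1 / (1 + K * t) ^ 2) := by positivity
    linarith
  · refine isUnitSubgradient_neg_deriv hε hPderiv fun v hv => ?_
    have := htmin hv
    simpa only [mem_ofPred_eq, hgt, EReal.coe_add] using this

/-- Near a point `τ ∈ [0, 1)` where `g` lies above the affine function of slope `m` through
`(τ, g τ)`, there are subgradients of slope at least `m - δ` that satisfy the sign condition imposed
by the tangent cone at the left end; at an interior point `τ` the slope is `m` exactly. -/
theorem exists_subgradient_near {g : ℝ → EReal}
    (hlsc : LowerSemicontinuousOn g (Icc 0 1)) {τ y m ε δ : ℝ} (hτ : τ ∈ Ico (0 : ℝ) 1)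
    (hy : g τ = (y : EReal))
    (hmin : ∀ t ∈ Icc (0 : ℝ) 1, ((y + m * (t - τ) : ℝ) : EReal) ≤ g t)
    (hε : 0 < ε) (hδ : 0 < δ) :
    ∃ t z s : ℝ, t ∈ Ico (0 : ℝ) 1 ∧ |t - τ| < δ ∧ g t = (z : EReal) ∧ |z - y| < δ ∧ m - δ ≤ s ∧
      (t = 0 → 0 ≤ s) ∧ (τ ≠ 0 → s = m) ∧ IsUnitSubgradient ε g t z s := by
  by_cases hcase : τ = 0 ∧ m < 0
  · obtain ⟨rfl, hm⟩ := hcase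
    by_cases hzero : IsUnitSubgradient ε g 0 y 0
    · exact ⟨0, y, 0, hτ, by simpa, hy, by simpa, by linarith, fun _ => le_rfl, by simp, hzero⟩
    · obtain ⟨t, z, s, ht, htδ, hz, hzy, hs, hsub⟩ := exists_subgradient_near_left_end hlsc hy hm
        (by simpa only [sub_zero] using hmin) hε hδ hzero
      refine ⟨t, z, s, ⟨ht.1.le, ht.2⟩, ?_, hz, hzy, hs, fun h => absurd h ht.1.ne', by simp, hsub⟩
      rwa [sub_zero, abs_of_pos ht.1]
  · refine ⟨τ, y, m, hτ, by simpa, hy, by simpa, by linarith, fun h => ?_, fun _ => rfl,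
      1, one_pos, fun u hu _ => le_trans ?_ (hmin u hu)⟩
    · by_contra! hm
      exact hcase ⟨h, hm⟩
    · rw [EReal.coe_le_coe_iff]
      linarith [mul_nonneg hε.le (abs_nonneg (u - τ))]

/-! ### From slopes to functionals -/

section Segment

variable {X : Type*} [NormedAddCommGroup X] [NormedSpace ℝ X]

theorem lineMap_mem_segment (a b : X) {t : ℝ} (ht : t ∈ Icc (0 : ℝ) 1) :
    AffineMap.lineMap a b t ∈ segment ℝ a b := by
  rw [segment_eq_image_lineMap]
  exact mem_image_of_mem _ ht

/-- At `a + t (b - a)` with `0 ≤ t < 1`, the direction `κ (b - a)` is tangent to the segment for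
every real `κ` if `0 < t`, and for `κ ≥ 0` if `t = 0`. -/
theorem smul_sub_mem_tangentCone_segment (a b : X) {t κ : ℝ} (ht : t ∈ Ico (0 : ℝ) 1)
    (hκ : t = 0 → 0 ≤ κ) :
    κ • (b - a) ∈ tangentCone (AffineMap.lineMap a b t) (segment ℝ a b) := by
  obtain ⟨r, hr, hmem⟩ : ∃ r : ℝ, 0 < r ∧ ∀ q : ℝ, 0 < q → q < r → t + q * κ ∈ Icc (0 : ℝ) 1 := by
    have hcont : Tendsto (fun q : ℝ => t + q * κ) (𝓝 0) (𝓝 t) := by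
      have : Continuous fun q : ℝ => t + q * κ := by fun_prop
      simpa using this.tendsto 0
    have hpos : ∀ᶠ q in 𝓝 (0 : ℝ), 0 < q → 0 ≤ t + q * κ := by
      rcases ht.1.eq_or_lt with h | h
      · refine Eventually.of_forall fun q hq => ?_
        have := mul_nonneg hq.le (hκ h.symm)
        linarith
      · filter_upwards [hcont.eventually_const_lt h] with q hq _ using hq.le
    obtain ⟨r, hr, hball⟩ :=
      Metric.eventually_nhds_iff.1 (hpos.and (hcont.eventually_lt_const ht.2))
    refine ⟨r, hr, fun q hq hqr => ?_⟩
    have := hball (y := q) (by rwa [Real.dist_eq, sub_zero, abs_of_pos hq])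
    exact ⟨this.1 hq, this.2.le⟩
  refine ⟨fun k => r / 2 * (1 / ((k : ℝ) + 1)), fun _ => κ • (b - a), fun k => by positivity, ?_,
    tendsto_const_nhds, fun k => ?_⟩
  · simpa using tendsto_one_div_add_atTop_nhds_zero_nat.const_mul (r / 2)
  · set q : ℝ := r / 2 * (1 / ((k : ℝ) + 1)) with hq
    have hqpos : 0 < q := by positivity
    have hqr : q < r := by
      have : 1 / ((k : ℝ) + 1) ≤ 1 := by
        rw [div_le_one (by positivity)]
        linarith [(Nat.cast_nonneg k : (0 : ℝ) ≤ k)]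
      nlinarith
    have := lineMap_mem_segment a b (hmem q hqpos hqr)
    convert this using 1
    simp only [AffineMap.lineMap_apply_module']
    module

/-- An `ε`-subgradient of `f` along the segment gives a geometric subgradient of the restriction of
`f` to the segment. The tolerance is scaled by `‖b - a‖` because the segment is parametrized by
`[0, 1]`. -/
theorem mem_geomSubdiff_of_isUnitSubgradient {f : X → EReal} {a b : X} (hab : a ≠ b)
    {t y s ε : ℝ} (ht : t ∈ Icc (0 : ℝ) 1) (hy : f (AffineMap.lineMap a b t) = (y : EReal))
    (hε : 0 ≤ ε)
    (hsub : IsUnitSubgradient (ε * ‖b - a‖) (fun u => f (AffineMap.lineMap a b u)) t y s)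
    {xs : StrongDual ℝ X} (hxs : xs (b - a) = s) :
    xs ∈ geomSubdiff ε (restrictTop f (segment ℝ a b)) (AffineMap.lineMap a b t) := by
  have hL : 0 < ‖b - a‖ := norm_pos_iff.2 (sub_ne_zero.2 hab.symm)
  have hval : restrictTop f (segment ℝ a b) (AffineMap.lineMap a b t) = (y : EReal) := by
    rw [restrictTop, if_pos (lineMap_mem_segment a b ht), hy]
  refine ⟨by simp [hval], by simp [hval], ?_⟩
  rw [hval, EReal.toReal_coe]
  set p : WithLp 1 (X × ℝ) := WithLp.toLp 1 (AffineMap.lineMap a b t, y)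
  refine ⟨?_, ?_⟩
  · change restrictTop f (segment ℝ a b) (AffineMap.lineMap a b t) ≤ (y : EReal)
    exact hval.le
  obtain ⟨r, hr, hsub⟩ := hsub
  refine limsup_le_of_le (by isBoundedDefault) ?_
  have hball : ∀ᶠ q in 𝓝[epigraph (restrictTop f (segment ℝ a b)) \ {p}] p,
      dist q p < r * ‖b - a‖ :=
    nhdsWithin_le_nhds (Metric.ball_mem_nhds p (mul_pos hr hL))
  filter_upwards [hball, self_mem_nhdsWithin] with q hq hqmem
  have hepi : restrictTop f (segment ℝ a b) q.fst ≤ (q.snd : EReal) := hqmem.1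
  have hqseg : q.fst ∈ segment ℝ a b := by
    by_contra h
    rw [restrictTop, if_neg h, top_le_iff] at hepi
    exact EReal.coe_ne_top _ hepi
  rw [restrictTop, if_pos hqseg] at hepi
  have hnorm : ‖q - p‖ = ‖q.fst - AffineMap.lineMap a b t‖ + |q.snd - y| := by
    rw [WithLp.prod_norm_eq_of_L1]
    rfl
  rw [segment_eq_image_lineMap] at hqseg
  obtain ⟨u, hu, hqu⟩ := hqseg
  have hdiff : q.fst - AffineMap.lineMap a b t = (u - t) • (b - a) := by
    rw [← hqu]
    simp only [AffineMap.lineMap_apply_module']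
    module
  have hfst : ‖q.fst - AffineMap.lineMap a b t‖ = |u - t| * ‖b - a‖ := by
    rw [hdiff, norm_smul, Real.norm_eq_abs]
  have hut : |u - t| < r := by
    rw [dist_eq_norm, hnorm, hfst] at hq
    exact lt_of_mul_lt_mul_right (lt_of_le_of_lt (by linarith [abs_nonneg (q.snd - y)]) hq) hL.le
  have hineq := (hsub u hu hut).trans (by simpa only [hqu] using hepi)
  rw [EReal.coe_le_coe_iff] at hineq
  rw [EReal.coe_le_coe_iff]
  refine div_le_of_le_mul₀ (norm_nonneg _) hε ?_
  have happ : pairFunctional xs (-1) (q - p) = s * (u - t) - (q.snd - y) := by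
    rw [pairFunctional_apply]
    change xs (q.fst - AffineMap.lineMap a b t) + -1 * (q.snd - y) = _
    rw [hdiff, map_smul, hxs, smul_eq_mul]
    ring
  rw [happ, hnorm, hfst]
  have := mul_nonneg hε (abs_nonneg (q.snd - y))
  linarith

/-- A slope `s` that is a subgradient along the segment is realized by an element of the relative
subdifferential: the multiple of a norming functional of `b - a` with value `s` at `b - a`. -/
theorem exists_mem_relSubdiff {f : X → EReal} {a b : X} (hab : a ≠ b)
    {t y s ε : ℝ} (ht : t ∈ Ico (0 : ℝ) 1) (hy : f (AffineMap.lineMap a b t) = (y : EReal))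
    (hε : 0 ≤ ε) (hs : t = 0 → 0 ≤ s)
    (hsub : IsUnitSubgradient (ε * ‖b - a‖) (fun u => f (AffineMap.lineMap a b u)) t y s) :
    ∃ xs ∈ relSubdiff ε (segment ℝ a b) f (AffineMap.lineMap a b t), xs (b - a) = s := by
  have hne : b - a ≠ 0 := sub_ne_zero.2 hab.symm
  have hL : 0 < ‖b - a‖ := norm_pos_iff.2 hne
  obtain ⟨j, hj, hjv⟩ := exists_dual_vector ℝ (b - a) hL.ne'
  have htIcc : t ∈ Icc (0 : ℝ) 1 := ⟨ht.1, ht.2.le⟩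
  have hjv' : j (b - a) = ‖b - a‖ := by simpa using hjv
  have hxs : ((s / ‖b - a‖) • j) (b - a) = s := by
    rw [smul_apply, hjv', smul_eq_mul, div_mul_cancel₀ _ hL.ne']
  refine ⟨(s / ‖b - a‖) • j, ⟨lineMap_mem_segment a b htIcc,
    mem_geomSubdiff_of_isUnitSubgradient hab htIcc hy hε hsub hxs, ?_⟩, hxs⟩
  refine mem_biUnion (smul_sub_mem_tangentCone_segment (κ := s / ‖b - a‖ ^ 2) a b ht fun h => ?_) ?_
  · exact div_nonneg (hs h) (by positivity)
  · have hnorm : ‖(s / ‖b - a‖ ^ 2) • (b - a)‖ ^ 2 = (s / ‖b - a‖) ^ 2 := by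
      rw [norm_smul, mul_pow, Real.norm_eq_abs, sq_abs]
      field_simp
    constructor
    · rw [hnorm, map_smul, hxs, smul_eq_mul]
      field_simp
    · rw [hnorm, norm_smul, hj, mul_one, Real.norm_eq_abs, sq_abs]

end Segment

end RelSubdiff

theorem theorem5p1
    {X : Type*} [NormedAddCommGroup X] [NormedSpace ℝ X] [CompleteSpace X]
    (hrefl : RelSubdiff.Reflexive X)
    (hluc : RelSubdiff.LocallyUniformlyConvex X)
    (hlucDual : RelSubdiff.LocallyUniformlyConvex (StrongDual ℝ X))
    (hnorm : ∀ x : X, x ≠ 0 → DifferentiableAt ℝ (fun y : X => ‖y‖) x)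
    (f : X → EReal) (a b : X) (hab : a ≠ b)
    (hfa : f a ≠ ⊤ ∧ f a ≠ ⊥) (hfb : f b ≠ ⊤ ∧ f b ≠ ⊥)
    (hproper : ∀ x ∈ segment ℝ a b, f x ≠ ⊥)
    (hlsc : LowerSemicontinuousOn f (segment ℝ a b))
    (c : X) (hc : c ∈ segment ℝ a b \ {b})
    (hmin : IsMinOn
      (fun x : X => f x +
        ((((f b).toReal - (f a).toReal) / ‖b - a‖ * ‖x - b‖ : ℝ) : EReal))
      (segment ℝ a b) c)
    (ε : ℕ → ℝ) (hεpos : ∀ k, 0 < ε k) (hεanti : Antitone ε) (hε : Tendsto ε atTop (𝓝 0)) :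
    ∃ (ε' : ℕ → ℝ) (x : ℕ → X) (xs : ℕ → StrongDual ℝ X),
      (∀ k, 0 < ε' k) ∧ Tendsto ε' atTop (𝓝 0) ∧
      (∀ k, x k ∈ segment ℝ a b) ∧ Tendsto x atTop (𝓝 c) ∧
      Tendsto (fun k => f (x k)) atTop (𝓝 (f c)) ∧
      (∀ k, xs k ∈ RelSubdiff.relSubdiff (ε' k) (segment ℝ a b) f (x k)) ∧
      (((f b).toReal - (f a).toReal : ℝ) : EReal) ≤
        liminf (fun k => ((xs k (b - a) : ℝ) : EReal)) atTop ∧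
      ((‖b - c‖ / ‖b - a‖ * ((f b).toReal - (f a).toReal) : ℝ) : EReal) ≤
        liminf (fun k => ((xs k (b - x k) : ℝ) : EReal)) atTop ∧
      (c ≠ a → Tendsto (fun k => xs k (b - a)) atTop (𝓝 ((f b).toReal - (f a).toReal))) := by
  have hL : 0 < ‖b - a‖ := norm_pos_iff.2 (sub_ne_zero.2 hab.symm)
  set m : ℝ := (f b).toReal - (f a).toReal with hm
  obtain ⟨hcseg, hcb⟩ := hc
  obtain ⟨τ, hτIcc, rfl⟩ : ∃ τ ∈ Set.Icc (0 : ℝ) 1, AffineMap.lineMap a b τ = c := by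
    rwa [segment_eq_image_lineMap] at hcseg
  have hτ : τ ∈ Set.Ico (0 : ℝ) 1 :=
    ⟨hτIcc.1, lt_of_le_of_ne hτIcc.2 fun h => hcb (by simp [h])⟩
  have hdist : ∀ t ≤ (1 : ℝ), ‖AffineMap.lineMap a b t - b‖ = (1 - t) * ‖b - a‖ := fun t ht => by
    rw [← dist_eq_norm, dist_lineMap_right, Real.norm_of_nonneg (sub_nonneg.2 ht), dist_comm,
      dist_eq_norm]
  have hφ : ∀ t ∈ Set.Icc (0 : ℝ) 1,
      f (AffineMap.lineMap a b τ) + ((m * (1 - τ) : ℝ) : EReal) ≤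
        f (AffineMap.lineMap a b t) + ((m * (1 - t) : ℝ) : EReal) := fun t ht => by
    have key : ∀ u ≤ (1 : ℝ), m / ‖b - a‖ * ‖AffineMap.lineMap a b u - b‖ = m * (1 - u) :=
      fun u hu => by
        rw [hdist u hu]
        field_simp
    have := hmin (RelSubdiff.lineMap_mem_segment a b ht)
    simpa only [Set.mem_ofPred_eq, key τ hτIcc.2, key t ht.2] using this
  -- The minimal value is at most `f b`, so `f` is finite at the minimizer.
  obtain ⟨y, hy⟩ : ∃ y : ℝ, f (AffineMap.lineMap a b τ) = (y : EReal) := by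
    refine ⟨_, (EReal.coe_toReal (fun h => ?_) (hproper _ hcseg)).symm⟩
    have := hφ 1 ⟨zero_le_one, le_rfl⟩
    rw [h, EReal.top_add_coe, top_le_iff] at this
    simp [hfb.1] at this
  have hsupport : ∀ t ∈ Set.Icc (0 : ℝ) 1,
      ((y + m * (t - τ) : ℝ) : EReal) ≤ f (AffineMap.lineMap a b t) := fun t ht => by
    have h := hφ t ht
    have hbot := hproper _ (RelSubdiff.lineMap_mem_segment a b ht)
    induction hft : f (AffineMap.lineMap a b t) with
    | top => exact le_top
    | bot => exact absurd hft hbot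
    | coe z =>
      rw [hy, hft, ← EReal.coe_add, ← EReal.coe_add, EReal.coe_le_coe_iff] at h
      rw [EReal.coe_le_coe_iff]
      linarith
  have hg : LowerSemicontinuousOn (fun t : ℝ => f (AffineMap.lineMap a b t)) (Set.Icc 0 1) :=
    hlsc.comp (f := f) (g := fun t : ℝ => AffineMap.lineMap a b t)
      AffineMap.lineMap_continuous.continuousOn
      fun t ht => RelSubdiff.lineMap_mem_segment a b ht
  have hδpos : ∀ k : ℕ, 0 < 1 / ((k : ℝ) + 1) := fun k => by positivity
  have hδ : Tendsto (fun k : ℕ => 1 / ((k : ℝ) + 1)) atTop (𝓝 0) :=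
    tendsto_one_div_add_atTop_nhds_zero_nat
  choose t z s ht htτ hz hzy hs hs0 hsm hsub using fun k : ℕ =>
    RelSubdiff.exists_subgradient_near hg hτ hy hsupport (mul_pos (hεpos k) hL) (hδpos k)
  choose xs hxs hxsv using fun k : ℕ =>
    RelSubdiff.exists_mem_relSubdiff hab (ht k) (hz k) (hεpos k).le (hs0 k) (hsub k)
  have httend : Tendsto t atTop (𝓝 τ) :=
    tendsto_iff_dist_tendsto_zero.2 (squeeze_zero (fun _ => dist_nonneg) (fun k => (htτ k).le) hδ)
  have hztend : Tendsto z atTop (𝓝 y) :=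
    tendsto_iff_dist_tendsto_zero.2 (squeeze_zero (fun _ => dist_nonneg) (fun k => (hzy k).le) hδ)
  have hlower : Tendsto (fun k : ℕ => m - 1 / ((k : ℝ) + 1)) atTop (𝓝 m) := by
    simpa using hδ.const_sub m
  have hxsb : ∀ k, xs k (b - AffineMap.lineMap a b (t k)) = s k * (1 - t k) := fun k => by
    have : b - AffineMap.lineMap a b (t k) = (1 - t k) • (b - a) := by
      simp only [AffineMap.lineMap_apply_module']
      module
    rw [this, map_smul, hxsv, smul_eq_mul, mul_comm]
  -- A real sequence bounded below by one tending to `l` has lower limit at least `l`.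
  have hliminf : ∀ {u w : ℕ → ℝ} {l : ℝ}, Tendsto u atTop (𝓝 l) → (∀ k, u k ≤ w k) →
      (l : EReal) ≤ liminf (fun k => (w k : EReal)) atTop := fun {u w l} hu huw => by
    have h := ((continuous_coe_real_ereal.tendsto l).comp hu).liminf_eq
    rw [← h]
    exact liminf_le_liminf (Eventually.of_forall fun k => EReal.coe_le_coe_iff.2 (huw k))
  refine ⟨ε, fun k => AffineMap.lineMap a b (t k), xs, hεpos, hε,
    fun k => RelSubdiff.lineMap_mem_segment a b ⟨(ht k).1, (ht k).2.le⟩, ?_, ?_, hxs, ?_, ?_, ?_⟩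
  · exact (AffineMap.lineMap_continuous.tendsto τ).comp httend
  · simp only [hz, hy]
    exact (continuous_coe_real_ereal.tendsto y).comp hztend
  · simp only [hxsv]
    exact hliminf hlower hs
  · simp only [hxsb]
    refine hliminf (u := fun k => (m - 1 / ((k : ℝ) + 1)) * (1 - t k)) ?_ fun k =>
      mul_le_mul_of_nonneg_right (hs k) (sub_nonneg.2 (ht k).2.le)
    rw [norm_sub_rev, hdist τ hτIcc.2, mul_div_cancel_right₀ _ hL.ne', mul_comm (1 - τ)]
    exact hlower.mul (httend.const_sub 1)
  · intro hca
    have hτ0 : τ ≠ 0 := fun h => hca (by simp [h])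
    simp only [hxsv, hsm _ hτ0]
    exact tendsto_const_nhds
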